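/- Let $G$ be a connected graph (simple, undirected, with arbitrarily many vertices). A ray of $G$ is a one-way infinite path in $G$; two rays are equivalent if no finite set of vertices separates them in $G$, and the vertex ends of $G$ are the equivalence classes of rays. A vertex $v$ dominates a vertex end $\omega$ if for some (equivalently, every) ray $R$ belonging to $\omega$ there are infinitely many non-trivial paths from $v$ to $R$, pairwise vertex-disjoint except at $v$. The topological ends of $G$ are the vertex ends that are not dominated by any vertex of $G$. Then $G$ has a spanning tree $T$ with a root $r\in V(G)$ that is end-faithful for the topological ends of $G$: for every topological end $\omega$ of $G$, the tree $T$ contains exactly one ray that starts at $r$ and belongs to $\omega$. -/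

import Mathlib

namespace SimpleGraph

universe u

variable {V : Type u}

/-- A ray (one-way infinite path) of `G`, listed from its starting vertex `R 0`: pairwise distinct
vertices, consecutive ones adjacent. -/
@[ext]
structure Ray (G : SimpleGraph V) where
  toFun : ℕ → V
  injective : Function.Injective toFun
  adj : ∀ n, G.Adj (toFun n) (toFun (n + 1))

namespace Ray

variable {G : SimpleGraph V}

instance : CoeFun (Ray G) (fun _ => ℕ → V) := ⟨Ray.toFun⟩

/-- A ray of a subgraph of `G` on the same vertex set, seen as a ray of `G`. -/
def mapLe {T : SimpleGraph V} (h : T ≤ G) (R : Ray T) : Ray G where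
  toFun := R
  injective := R.injective
  adj n := h (R.adj n)

/-- Two rays are equivalent if no finite set `S` of vertices separates them: for every finite `S`
there is a walk of `G` avoiding `S` from a vertex of the one to a vertex of the other. -/
def Equivalent (R R' : Ray G) : Prop :=
  ∀ S : Finset V, ∃ (i j : ℕ) (p : G.Walk (R i) (R' j)), ∀ x ∈ p.support, x ∉ S

theorem exists_tail (R : Ray G) (S : Finset V) : ∃ N, ∀ n ≥ N, R n ∉ S := by
  have hfin : (R.toFun ⁻¹' (S : Set V)).Finite :=
    S.finite_toSet.preimage R.injective.injOn
  obtain ⟨N, hN⟩ := hfin.bddAbove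
  refine ⟨N + 1, fun n hn hS => ?_⟩
  have h1 : n ≤ N := hN (by simpa using hS)
  omega

theorem exists_walk_of_le (R : Ray G) (m k : ℕ) :
    ∃ p : G.Walk (R m) (R (m + k)), ∀ x ∈ p.support, ∃ n ≥ m, x = R n := by
  induction k with
  | zero => exact ⟨Walk.nil, fun x hx => ⟨m, le_rfl, by simpa using hx⟩⟩
  | succ k ih =>
    obtain ⟨p, hp⟩ := ih
    refine ⟨p.concat (R.adj (m + k)), fun x hx => ?_⟩
    rw [Walk.support_concat, List.mem_append, List.mem_singleton] at hx
    rcases hx with hx | hx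
    · exact hp x hx
    · exact ⟨m + k + 1, by omega, hx⟩

theorem exists_walk_avoiding (R : Ray G) (S : Finset V) (N : ℕ) (hN : ∀ n ≥ N, R n ∉ S)
    (i j : ℕ) (hi : N ≤ i) (hj : N ≤ j) :
    ∃ p : G.Walk (R i) (R j), ∀ x ∈ p.support, x ∉ S := by
  have key : ∀ i k, N ≤ i → ∃ p : G.Walk (R i) (R (i + k)), ∀ x ∈ p.support, x ∉ S := by
    intro i k hi
    obtain ⟨p, hp⟩ := R.exists_walk_of_le i k
    refine ⟨p, fun x hx => ?_⟩
    obtain ⟨n, hn, rfl⟩ := hp x hx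
    exact hN n (le_trans hi hn)
  rcases le_total i j with h | h
  · obtain ⟨k, rfl⟩ := Nat.exists_eq_add_of_le h
    exact key i k hi
  · obtain ⟨k, rfl⟩ := Nat.exists_eq_add_of_le h
    obtain ⟨p, hp⟩ := key j k hj
    exact ⟨p.reverse, fun x hx => hp x (by simpa using hx)⟩

theorem Equivalent.refl (R : Ray G) : R.Equivalent R := by
  intro S
  obtain ⟨N, hN⟩ := R.exists_tail S
  exact ⟨N, N, Walk.nil, by simpa using hN N le_rfl⟩

theorem Equivalent.symm {R R' : Ray G} (h : R.Equivalent R') : R'.Equivalent R := by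
  intro S
  obtain ⟨i, j, p, hp⟩ := h S
  exact ⟨j, i, p.reverse, fun x hx => hp x (by simpa using hx)⟩

open Classical in
theorem Equivalent.trans {R R' R'' : Ray G} (h : R.Equivalent R') (h' : R'.Equivalent R'') :
    R.Equivalent R'' := by
  intro S
  obtain ⟨N, hN⟩ := R'.exists_tail S
  obtain ⟨i, j, p, hp⟩ := h (S ∪ (Finset.range N).image R')
  obtain ⟨j', k, q, hq⟩ := h' (S ∪ (Finset.range N).image R')
  have hj : N ≤ j := by
    by_contra hlt
    exact hp _ p.end_mem_support (Finset.mem_union_right _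
      (Finset.mem_image_of_mem _ (Finset.mem_range.2 (not_le.1 hlt))))
  have hj' : N ≤ j' := by
    by_contra hlt
    exact hq _ q.start_mem_support (Finset.mem_union_right _
      (Finset.mem_image_of_mem _ (Finset.mem_range.2 (not_le.1 hlt))))
  obtain ⟨w, hw⟩ := R'.exists_walk_avoiding S N hN j j' hj hj'
  refine ⟨i, k, p.append (w.append q), fun x hx hS => ?_⟩
  rw [Walk.mem_support_append_iff, Walk.mem_support_append_iff] at hx
  rcases hx with hx | hx | hx
  · exact hp x hx (Finset.mem_union_left _ hS)
  · exact hw x hx hS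
  · exact hq x hx (Finset.mem_union_left _ hS)

/-- Equivalence of rays is an equivalence relation. -/
instance setoid (G : SimpleGraph V) : Setoid (Ray G) where
  r := Equivalent
  iseqv := ⟨Equivalent.refl, Equivalent.symm, Equivalent.trans⟩

/-- There is an infinite fan of `v`-`R` paths: infinitely many nontrivial paths from `v` to vertices
of `R`, having no vertex in `R` (other than possibly `v`) before their last vertex, and pairwise
disjoint except at `v`. -/
def HasInfiniteFan (R : Ray G) (v : V) : Prop :=
  ∃ (e : ℕ → ℕ) (P : ∀ n, G.Walk v (R (e n))),
    (∀ n, (P n).IsPath) ∧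
    (∀ n, R (e n) ≠ v) ∧
    (∀ n i, R i ∈ (P n).support → R i = v ∨ i = e n) ∧
    (∀ m n, m ≠ n → ∀ x ∈ (P m).support, x ∈ (P n).support → x = v)

end Ray

/-- The vertex ends of `G`: equivalence classes of rays. -/
def VertexEnd (G : SimpleGraph V) : Type u := Quotient (Ray.setoid G)

/-- The vertex end to which the ray `R` belongs. -/
def Ray.vertexEnd {G : SimpleGraph V} (R : Ray G) : VertexEnd G := Quotient.mk (Ray.setoid G) R

/-- The vertex `v` dominates the vertex end `ω`: some ray belonging to `ω` has an infinite fan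
from `v`. -/
def VertexEnd.DominatedBy {G : SimpleGraph V} (ω : VertexEnd G) (v : V) : Prop :=
  ∃ R : Ray G, R.vertexEnd = ω ∧ R.HasInfiniteFan v

/-- The topological ends of `G`: the vertex ends that are dominated by no vertex. -/
def topologicalEnds (G : SimpleGraph V) : Set (VertexEnd G) :=
  {ω | ∀ v : V, ¬ ω.DominatedBy v}

/-- The spanning subgraph `T` of `G` with root `r` is a rooted spanning tree of `G` that is
end-faithful for the set `Ψ` of vertex ends of `G`: every `ω ∈ Ψ` has exactly one ray belonging
to it that lies in `T` and starts at `r`. -/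
structure IsEndFaithfulSpanningTree (G T : SimpleGraph V) (r : V) (Ψ : Set (VertexEnd G)) :
    Prop where
  le : T ≤ G
  isTree : T.IsTree
  existsUnique_ray : ∀ ω ∈ Ψ, ∃! R : Ray T, R 0 = r ∧ (R.mapLe le).vertexEnd = ω

end SimpleGraph

/-! A ray of an undominated end is finitely separated from every ball around `r`, by induction on
the radius: a separator for one ball contains every vertex of that ball with a neighbour on the
ray's side, and, since none of them dominates the end, each can be cut off from the ray by finitely
many vertices (`Ray.finSep_ballAround`).

The graph is then exhausted by sets `W n` that swallow the balls, yet from which all such rays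
remain finitely separated (`exists_isExtension`). Each component outside `W (n + 1)` receives a
root, and the spanning tree is built so that this root is an ancestor of every vertex of the
component (`exists_isParent`).

Two rays of a topological end have tails in the same component outside `W (n + 1)`. If they are tree
rays from `r`, both pass through its root and agree up to there; letting `n` grow gives uniqueness.
For existence, the roots of the components holding tails of a given ray of the end are successive
ancestors, so they lie on one tree ray. It is equivalent to the given ray because every finite set
lies in some `W n`. -/

namespace SimpleGraph

universe u

variable {V : Type u} {G : SimpleGraph V}

/-- `x` and `y` are joined by a walk of `G` inside the vertex set `A`. -/
def ConnIn (G : SimpleGraph V) (A : Set V) (x y : V) : Prop :=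
  ∃ p : G.Walk x y, ∀ z ∈ p.support, z ∈ A

/-! ### Connection inside a vertex set -/

namespace ConnIn

variable {A B : Set V} {x y z : V}

theorem refl (h : x ∈ A) : G.ConnIn A x x := ⟨Walk.nil, by simpa using h⟩

theorem symm (h : G.ConnIn A x y) : G.ConnIn A y x := by
  obtain ⟨p, hp⟩ := h
  exact ⟨p.reverse, fun z hz => hp z (by simpa using hz)⟩

theorem trans (h : G.ConnIn A x y) (h' : G.ConnIn A y z) : G.ConnIn A x z := by
  obtain ⟨p, hp⟩ := h
  obtain ⟨q, hq⟩ := h'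
  refine ⟨p.append q, fun w hw => ?_⟩
  rw [Walk.mem_support_append_iff] at hw
  exact hw.elim (hp w) (hq w)

theorem mono (hAB : A ⊆ B) (h : G.ConnIn A x y) : G.ConnIn B x y := by
  obtain ⟨p, hp⟩ := h
  exact ⟨p, fun z hz => hAB (hp z hz)⟩

theorem of_subset {S S' : Finset V} (hS : S ⊆ S') (h : G.ConnIn {z | z ∉ S'} x y) :
    G.ConnIn {z | z ∉ S} x y :=
  h.mono fun _ (hz : _ ∉ S') hzS => hz (hS hzS)

theorem left_mem (h : G.ConnIn A x y) : x ∈ A := by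
  obtain ⟨p, hp⟩ := h
  exact hp _ p.start_mem_support

theorem right_mem (h : G.ConnIn A x y) : y ∈ A := h.symm.left_mem

theorem of_adj (h : G.Adj x y) (hx : x ∈ A) (hy : y ∈ A) : G.ConnIn A x y :=
  ⟨h.toWalk, by simp [hx, hy]⟩

/-- If everything joined to `x` inside `A` lies in `B`, then so do the joining walks. -/
theorem of_forall (h : G.ConnIn A x y) (hB : ∀ z, G.ConnIn A x z → z ∈ B) : G.ConnIn B x y := by
  obtain ⟨p, hp⟩ := h
  induction p with
  | nil => exact refl (hB _ (refl (hp _ (by simp))))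
  | @cons a b c hab q ih =>
    have ha : a ∈ A := hp _ (by simp)
    have hb : b ∈ A := hp _ (by simp)
    have hab' : G.ConnIn A a b := of_adj hab ha hb
    exact (of_adj hab (hB _ (refl ha)) (hB _ hab')).trans
      (ih (fun z hz => hB z (hab'.trans hz)) fun z hz => hp z (by simp [hz]))

/-- A walk leaving `B` does so along an edge. -/
theorem exists_boundary (h : G.ConnIn A x y) (hx : x ∈ B) (hy : y ∉ B) :
    ∃ u w, G.ConnIn B x u ∧ G.Adj u w ∧ w ∈ A ∧ w ∉ B := by
  obtain ⟨p, hp⟩ := h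
  induction p with
  | nil => exact absurd hx hy
  | @cons a b c hab q ih =>
    by_cases hb : b ∈ B
    · obtain ⟨u, w, h1, h2⟩ := ih hb hy fun z hz => hp z (by simp [hz])
      exact ⟨u, w, (of_adj hab hx hb).trans h1, h2⟩
    · exact ⟨a, b, refl hx, hab, hp _ (by simp), hb⟩

end ConnIn

/-! ### Finite separation and fans -/

namespace Ray

theorem connIn_tail (R : Ray G) {A : Set V} {N : ℕ} (hN : ∀ n ≥ N, R n ∈ A) {i j : ℕ}
    (hi : N ≤ i) (hj : N ≤ j) : G.ConnIn A (R i) (R j) := by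
  have key : ∀ i, N ≤ i → G.ConnIn A (R N) (R i) := by
    intro i hi
    induction i, hi using Nat.le_induction with
    | base => exact ConnIn.refl (hN N le_rfl)
    | succ i hi ih =>
      exact ih.trans (ConnIn.of_adj (R.adj i) (hN i hi) (hN (i + 1) (by omega)))
  exact (key i hi).symm.trans (key j hj)

/-- Some finite set of vertices separates a tail of the ray from `U`. -/
def FinSep (R : Ray G) (U : Set V) : Prop :=
  ∃ (S : Finset V) (N : ℕ), (∀ n ≥ N, R n ∉ S) ∧
    ∀ y, G.ConnIn {z | z ∉ S} (R N) y → y ∉ U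

theorem finSep_empty (R : Ray G) : R.FinSep ∅ := ⟨∅, 0, by simp, by simp⟩

theorem finSep_singleton (R : Ray G) (v : V) : R.FinSep {v} := by
  obtain ⟨N, hN⟩ := R.exists_tail {v}
  refine ⟨{v}, N, hN, fun y hy => ?_⟩
  simpa using hy.right_mem

open Classical in
theorem FinSep.union {R : Ray G} {U U' : Set V} (h : R.FinSep U) (h' : R.FinSep U') :
    R.FinSep (U ∪ U') := by
  obtain ⟨S, N, hN, hS⟩ := h
  obtain ⟨S', N', hN', hS'⟩ := h'
  refine ⟨S ∪ S', max N N', fun n hn => ?_, fun y hy => ?_⟩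
  · simp only [ge_iff_le, sup_le_iff] at hn
    simp [hN n hn.1, hN' n hn.2]
  · have h1 : G.ConnIn {z | z ∉ S} (R (max N N')) y :=
      hy.of_subset Finset.subset_union_left
    have h2 : G.ConnIn {z | z ∉ S'} (R (max N N')) y :=
      hy.of_subset Finset.subset_union_right
    rintro (hyU | hyU)
    · exact hS y ((R.connIn_tail (A := {z | z ∉ S}) hN le_rfl (le_max_left _ _)).trans h1) hyU
    · exact hS' y ((R.connIn_tail (A := {z | z ∉ S'}) hN' le_rfl (le_max_right _ _)).trans h2) hyU

open Classical in
/-- Two equivalent rays have tails in the same component outside a set from which one of them is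
finitely separated. -/
theorem FinSep.connIn_of_equivalent {R R' : Ray G} {U : Set V} (h : R.FinSep U)
    (hR : R.Equivalent R') : ∃ i j, G.ConnIn Uᶜ (R i) (R' j) := by
  obtain ⟨S, N, hN, hS⟩ := h
  obtain ⟨i, j, p, hp⟩ := hR (S ∪ (Finset.range N).image R)
  have hi : N ≤ i := by
    by_contra hlt
    exact hp _ p.start_mem_support (Finset.mem_union_right _
      (Finset.mem_image_of_mem _ (Finset.mem_range.2 (not_le.1 hlt))))
  have h1 : G.ConnIn {z | z ∉ S} (R N) (R i) :=
    R.connIn_tail (A := {z | z ∉ S}) hN le_rfl hi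
  have h2 : G.ConnIn {z | z ∉ S} (R i) (R' j) :=
    ⟨p, fun z hz hzS => hp z hz (Finset.mem_union_left _ hzS)⟩
  exact ⟨i, j, h2.of_forall fun z hz => hS z (h1.trans hz)⟩

theorem FinSep.exists_tail {R : Ray G} {U : Set V} (h : R.FinSep U) :
    ∃ N, ∀ n ≥ N, R n ∈ Uᶜ := by
  obtain ⟨S, N, hN, hS⟩ := h
  exact ⟨N, fun n hn => hS _ (R.connIn_tail (A := {z | z ∉ S}) hN le_rfl hn)⟩

open Classical in
/-- If no finite set avoiding `v` separates `v` from the rest of `R`, then there is an infinite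
`v`-`R` fan. -/
theorem hasInfiniteFan_of_forall (R : Ray G) (v : V)
    (h : ∀ F : Finset V, v ∉ F → ∃ i, R i ≠ v ∧ G.ConnIn {z | z ∉ F} v (R i)) :
    R.HasInfiniteFan v := by
  have h1 : ∀ F : Finset V, ∃ (i : ℕ) (p : G.Walk v (R i)), v ∉ F →
      p.IsPath ∧ R i ≠ v ∧ (∀ x ∈ p.support, x ∉ F) ∧
        ∀ j, R j ∈ p.support → R j = v ∨ R j = R i := by
    intro F
    by_cases hF : v ∈ F
    · obtain ⟨i, -, p, -⟩ := h ∅ (by simp)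
      exact ⟨i, p, fun h => absurd hF h⟩
    -- A shortest admissible walk meets `R` outside `v` only at its end: an earlier such vertex
    -- would give a shorter one.
    have hex : ∃ n, ∃ (i : ℕ) (p : G.Walk v (R i)), R i ≠ v ∧ (∀ x ∈ p.support, x ∉ F) ∧
        p.length = n := by
      obtain ⟨i, hi, p, hp⟩ := h F hF
      exact ⟨_, i, p, hi, hp, rfl⟩
    obtain ⟨i, p, hi, hp, hlen⟩ := Nat.find_spec hex
    have hmin : ∀ (j : ℕ) (q : G.Walk v (R j)), R j ≠ v → (∀ x ∈ q.support, x ∉ F) →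
        p.length ≤ q.length := fun j q hj hq => by
      rw [hlen]
      exact Nat.find_min' hex ⟨j, q, hj, hq, rfl⟩
    have hsub : ∀ x ∈ p.bypass.support, x ∉ F := fun x hx => hp x (p.support_bypass_subset_support hx)
    refine ⟨i, p.bypass, fun _ => ⟨p.bypass_isPath, hi, hsub, fun j hj => ?_⟩⟩
    by_contra! hcon
    have h2 := hmin j (p.bypass.takeUntil _ hj) hcon.1
      fun x hx => hsub x (Walk.support_takeUntil_subset_support _ hj hx)
    have h3 : (p.bypass.takeUntil _ hj).length + (p.bypass.dropUntil _ hj).length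
        = p.bypass.length := by
      rw [← Walk.length_append, Walk.take_spec]
    have h4 := p.length_bypass_le_length
    exact hcon.2 (Walk.eq_of_length_eq_zero (p := p.bypass.dropUntil _ hj) (by omega))
  choose e P hP using h1
  -- `F n` collects the vertices other than `v` of the paths already chosen; avoiding it makes the
  -- next path disjoint from them.
  let F : ℕ → Finset V := fun n =>
    Nat.rec ∅ (fun _ F => F ∪ (P F).support.toFinset.erase v) n
  have hF : ∀ n, F (n + 1) = F n ∪ (P (F n)).support.toFinset.erase v := fun n => rfl
  have hv : ∀ n, v ∉ F n := by
    intro n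
    induction n with
    | zero => simp [F]
    | succ n ih => rw [hF]; simp [ih]
  have hmono : Monotone F := monotone_nat_of_le_succ fun n => by
    rw [hF]; exact Finset.subset_union_left
  have hdis : ∀ m n, m < n → ∀ x ∈ (P (F m)).support, x ∈ (P (F n)).support → x = v := by
    intro m n hmn x hx hx'
    by_contra hxv
    refine (hP (F n) (hv n)).2.2.1 x hx' (hmono (Nat.succ_le_of_lt hmn) ?_)
    rw [hF]
    exact Finset.mem_union_right _ (Finset.mem_erase.2 ⟨hxv, List.mem_toFinset.2 hx⟩)
  refine ⟨fun n => e (F n), fun n => P (F n), fun n => (hP _ (hv n)).1,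
    fun n => (hP _ (hv n)).2.1, fun n i hi => ?_, fun m n hmn x hx hx' => ?_⟩
  · exact ((hP _ (hv n)).2.2.2 i hi).imp_right fun h => R.injective h
  · rcases lt_or_gt_of_ne hmn with h | h
    · exact hdis m n h x hx hx'
    · exact hdis n m h x hx' hx

end Ray

/-! ### Separating undominated ends from balls -/

/-- The ball of radius `n` around `r`. -/
def ballAround (G : SimpleGraph V) (r : V) : ℕ → Set V
  | 0 => {r}
  | n + 1 => {x | x ∈ ballAround G r n ∨ ∃ y ∈ ballAround G r n, G.Adj y x}

theorem exists_mem_ballAround (hG : G.Connected) (r x : V) : ∃ n, x ∈ G.ballAround r n := by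
  obtain ⟨p⟩ := hG.preconnected x r
  induction p with
  | nil => exact ⟨0, rfl⟩
  | cons h q ih =>
    obtain ⟨n, hn⟩ := ih
    exact ⟨n + 1, Or.inr ⟨_, hn, h.symm⟩⟩

open Classical in
/-- A ray of an undominated end is finitely separated from every ball. -/
theorem Ray.finSep_ballAround (R : Ray G) (hR : ∀ v, ¬ R.HasInfiniteFan v) (r : V) (n : ℕ) :
    R.FinSep (G.ballAround r n) := by
  have hF : ∀ v, ∃ F : Finset V, v ∉ F ∧ ∀ i, R i ≠ v → ¬ G.ConnIn {z | z ∉ F} v (R i) := by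
    intro v
    by_contra! hcon
    exact hR v (R.hasInfiniteFan_of_forall v hcon)
  choose F hvF hF using hF
  induction n with
  | zero => exact R.finSep_singleton r
  | succ n ih =>
    obtain ⟨S, N, hN, hS⟩ := ih
    obtain ⟨N', hN'⟩ := R.exists_tail (S ∪ S.biUnion F)
    refine ⟨S ∪ S.biUnion F, max N N', fun k hk => hN' k (le_trans (le_max_right _ _) hk),
      fun x hx hxn => ?_⟩
    have h1 : G.ConnIn {z | z ∉ S} (R N) x :=
      (R.connIn_tail (A := {z | z ∉ S}) hN le_rfl (le_max_left N N')).trans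
        (hx.of_subset Finset.subset_union_left)
    rcases hxn with hxn | ⟨y, hy, hyx⟩
    · exact hS x h1 hxn
    -- Outside `S`, the vertex `y` would lie on the ray's side and in the smaller ball. So only the
    -- finitely many sets `F y` with `y ∈ S` are needed.
    have hyS : y ∈ S := by
      by_contra hyS
      exact hS y (h1.trans (ConnIn.of_adj hyx.symm h1.right_mem hyS)) hy
    have h2 : G.ConnIn {z | z ∉ F y} (R (max N N')) x :=
      hx.of_subset ((Finset.subset_biUnion_of_mem F hyS).trans Finset.subset_union_right)
    refine hF y (max N N') (fun hEq => hN _ (le_max_left N N') (hEq ▸ hyS)) ?_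
    exact (ConnIn.of_adj hyx (hvF y) h2.right_mem).trans h2.symm

/-! ### Extending by one level -/

/-- `B` contains `A` and meets every component outside `A`. -/
def Meets (G : SimpleGraph V) (A B : Set V) : Prop :=
  A ⊆ B ∧ ∀ x ∉ A, ∃ b ∈ B, G.ConnIn Aᶜ x b

/-- A one-step extension of `B` to `B'`: the components outside `B` have roots, given by `a`, which
are attached to `B \ A`, and `f` is a parent function on `B' \ B` leading to these roots. -/
structure IsExtension (G : SimpleGraph V) (A B B' : Set V) (a f : V → V) (d : V → ℕ) : Prop where
  subset : B ⊆ B'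
  root_mem : ∀ x ∉ B, a x ∈ B'
  conn_root : ∀ x ∉ B, G.ConnIn Bᶜ x (a x)
  root_eq : ∀ x y, G.ConnIn Bᶜ x y → a x = a y
  adj : ∀ x ∈ B', x ∉ B → G.Adj x (f x)
  parent_mem : ∀ x ∈ B', x ∉ B → x ≠ a x → f x ∈ B' ∧ f x ∉ B ∧ d (f x) < d x
  parent_root_mem : ∀ x ∈ B', x ∉ B → x = a x → f x ∈ B ∧ f x ∉ A

theorem IsExtension.meets {A B B' : Set V} {a f : V → V} {d : V → ℕ}
    (h : G.IsExtension A B B' a f d) : G.Meets B B' :=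
  ⟨h.subset, fun x hx => ⟨a x, h.root_mem x hx, h.conn_root x hx⟩⟩

/-- A distinguished vertex and a decreasing parent function in every component outside `B`. -/
theorem exists_parent [Nonempty V] {A B : Set V} (h : G.Meets A B) :
    ∃ (a f : V → V) (d : V → ℕ), (∀ x ∉ B, G.ConnIn Bᶜ x (a x)) ∧
      (∀ x y, G.ConnIn Bᶜ x y → a x = a y) ∧ (∀ x ∉ B, G.Adj x (f x)) ∧
      (∀ x ∉ B, x ≠ a x → f x ∉ B ∧ d (f x) < d x) ∧
      (∀ x ∉ B, x = a x → f x ∈ B ∧ f x ∉ A) := by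
  classical
  -- `Q x` depends only on the component of `x`, so choosing by `epsilon` gives the whole component
  -- the same root.
  let Q : V → V → Prop := fun x y => G.ConnIn Bᶜ x y ∧ ∃ z, G.Adj y z ∧ z ∈ B ∧ z ∉ A
  let a : V → V := fun x => Classical.epsilon (Q x)
  have ha : ∀ x ∉ B, Q x (a x) := by
    intro x hx
    obtain ⟨b, hb, hxb⟩ := h.2 x fun hA => hx (h.1 hA)
    obtain ⟨u, w, h1, h2, h3, h4⟩ := hxb.exists_boundary (B := Bᶜ) hx (by simpa using hb)
    exact Classical.epsilon_spec (p := Q x) ⟨u, h1, w, h2, by simpa using h4, h3⟩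
  have haeq : ∀ x y, G.ConnIn Bᶜ x y → a x = a y := by
    intro x y hxy
    have : Q x = Q y := by
      funext z
      exact propext (and_congr_left' ⟨fun h => hxy.symm.trans h, fun h => hxy.trans h⟩)
    change Classical.epsilon (Q x) = Classical.epsilon (Q y)
    rw [this]
  -- `d x` is the distance from `x` to its root within the component; a shortest walk supplies the
  -- parent.
  let L : V → Set ℕ := fun x => {n | ∃ p : G.Walk x (a x), p.length = n ∧ ∀ z ∈ p.support, z ∈ Bᶜ}
  let d : V → ℕ := fun x => sInf (L x)
  have hf : ∀ x, ∃ y, x ∉ B → G.Adj x y ∧ (x ≠ a x → y ∉ B ∧ d y < d x) ∧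
      (x = a x → y ∈ B ∧ y ∉ A) := by
    intro x
    by_cases hx : x ∈ B
    · exact ⟨x, fun h => absurd hx h⟩
    by_cases hxa : x = a x
    · obtain ⟨-, z, hz, hzB⟩ := ha x hx
      rw [← hxa] at hz
      exact ⟨z, fun _ => ⟨hz, fun h => absurd hxa h, fun _ => hzB⟩⟩
    · have hne : (L x).Nonempty := by
        obtain ⟨p, hp⟩ := (ha x hx).1
        exact ⟨_, p, rfl, hp⟩
      obtain ⟨p, hp, hpB⟩ := Nat.sInf_mem hne
      obtain ⟨y, hxy, q, hq⟩ : ∃ (y : V) (_ : G.Adj x y) (q : G.Walk y (a x)),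
          q.length + 1 = p.length ∧ ∀ z ∈ q.support, z ∈ Bᶜ := by
        clear hp
        revert p hxa
        generalize a x = c
        intro hxa p hpB
        cases p with
        | nil => exact absurd rfl hxa
        | cons hxy q => exact ⟨_, hxy, q, rfl, fun z hz => hpB z (by simp [hz])⟩
      have hyB : y ∉ B := hq.2 y q.start_mem_support
      have hay : a x = a y := haeq x y (ConnIn.of_adj hxy hx hyB)
      refine ⟨y, fun _ => ⟨hxy, fun _ => ⟨hyB, ?_⟩, fun h => absurd h hxa⟩⟩
      have : d y ≤ q.length :=
        Nat.sInf_le ⟨q.copy rfl hay, by simp, by simpa using hq.2⟩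
      have h' : p.length = d x := hp
      omega
  choose f hf using hf
  exact ⟨a, f, d, fun x hx => (ha x hx).1, haeq, fun x hx => (hf x hx).1,
    fun x hx => (hf x hx).2.1, fun x hx => (hf x hx).2.2⟩


theorem finite_range_iterate {g : V → V} {d : V → ℕ} (hg : ∀ x, g x = x ∨ d (g x) < d x) (x : V) :
    (Set.range fun k => g^[k] x).Finite := by
  induction hn : d x using Nat.strong_induction_on generalizing x with
  | _ n ih =>
    rcases hg x with h | h
    · refine (Set.finite_singleton x).subset ?_
      rintro _ ⟨k, rfl⟩
      exact Function.iterate_fixed h k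
    · refine ((Set.finite_singleton x).union (ih _ (hn ▸ h) (g x) rfl)).subset ?_
      rintro _ ⟨k, rfl⟩
      cases k with
      | zero => exact Or.inl rfl
      | succ k => exact Or.inr ⟨k, rfl⟩

/-- The new set adds all roots and all parent paths from `U` to them. Although `U` may be infinite,
separation survives: on the ray's side of a separator `S` lie at most one root and vertices of
parent paths from `U`. Such a path must cross `S`, and then follows one of the finitely many finite
parent paths starting in `S`. -/
theorem exists_isExtension [Nonempty V] {A B : Set V} (h : G.Meets A B) (U : Set V) :
    ∃ (B' : Set V) (a f : V → V) (d : V → ℕ), G.IsExtension A B B' a f d ∧ U ⊆ B' ∧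
      ∀ R : Ray G, R.FinSep (B ∪ U) → R.FinSep B' := by
  classical
  obtain ⟨a, f, d, h1, h2, h3, h4, h5⟩ := exists_parent h
  -- The parent function frozen at the roots, so that its iterates never leave a component outside
  -- `B`.
  let g : V → V := fun x => if x ∉ B ∧ x ≠ a x then f x else x
  have hg : ∀ x, x ∉ B → x ≠ a x → g x = f x := fun x hx hxa => if_pos ⟨hx, hxa⟩
  have hgB : ∀ x, x ∉ B → g x ∉ B := by
    intro x hx
    by_cases hxa : x = a x
    · rwa [show g x = x from if_neg fun h => h.2 hxa]
    · rw [hg x hx hxa]; exact (h4 x hx hxa).1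
  have hgd : ∀ x, g x = x ∨ d (g x) < d x := by
    intro x
    by_cases hx : x ∉ B ∧ x ≠ a x
    · rw [hg x hx.1 hx.2]; exact Or.inr (h4 x hx.1 hx.2).2
    · exact Or.inl (if_neg hx)
  have hgadj : ∀ x, g x = x ∨ G.Adj x (g x) := by
    intro x
    by_cases hx : x ∉ B ∧ x ≠ a x
    · rw [hg x hx.1 hx.2]; exact Or.inr (h3 x hx.1)
    · exact Or.inl (if_neg hx)
  let Z : Set V := {z | z = a z ∨ ∃ u ∈ U, u ∉ B ∧ ∃ k, g^[k] u = z}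
  refine ⟨B ∪ {z | z ∉ B ∧ z ∈ Z}, a, f, d, ⟨Set.subset_union_left, ?_, h1, h2, fun x _ => h3 x,
    ?_, fun x _ => h5 x⟩, ?_, ?_⟩
  · exact fun x hx => Or.inr ⟨(h1 x hx).right_mem, Or.inl (h2 _ _ (h1 x hx))⟩
  · rintro x (hx | ⟨-, hx⟩) hxB hxa
    · exact absurd hx hxB
    · refine ⟨Or.inr ⟨(h4 x hxB hxa).1, Or.inr ?_⟩, h4 x hxB hxa⟩
      obtain ⟨u, hu, huB, k, rfl⟩ := hx.resolve_left hxa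
      exact ⟨u, hu, huB, k + 1, by rw [Function.iterate_succ_apply', hg _ hxB hxa]⟩
  · intro u hu
    by_cases huB : u ∈ B
    · exact Or.inl huB
    · exact Or.inr ⟨huB, Or.inr ⟨u, hu, huB, 0, rfl⟩⟩
  · rintro R ⟨S, N, hN, hS⟩
    have hfin : (({a (R N)} : Set V) ∪ ⋃ s ∈ S, Set.range fun k => g^[k] s).Finite :=
      (Set.finite_singleton _).union (S.finite_toSet.biUnion fun s _ => finite_range_iterate hgd s)
    obtain ⟨N', hN'⟩ := R.exists_tail (S ∪ hfin.toFinset)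
    refine ⟨S ∪ hfin.toFinset, max N N', fun n hn => hN' n (le_trans (le_max_right _ _) hn),
      fun y hy hyB => ?_⟩
    have hRy : G.ConnIn {z | z ∉ S} (R N) y :=
      (R.connIn_tail (A := {z | z ∉ S}) hN le_rfl (le_max_left N N')).trans
        (hy.of_subset Finset.subset_union_left)
    refine hy.right_mem (Finset.mem_union_right _ (hfin.mem_toFinset.2 ?_))
    rcases hyB with hyB | ⟨hyB, hya | ⟨u, hu, huB, k, rfl⟩⟩
    · exact absurd (Or.inl hyB) (hS y hRy)
    · refine Or.inl ?_
      rw [Set.mem_singleton_iff, hya]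
      exact (h2 _ _ (hRy.of_forall fun z hz hzB => hS z hz (Or.inl hzB))).symm
    · refine Or.inr ?_
      by_contra hcon
      simp only [Set.mem_iUnion, Set.mem_range, not_exists] at hcon
      -- A parent path missing `S` would connect `u ∈ U` to the ray's side.
      have key : ∀ i ≤ k, G.ConnIn {z | z ∉ S} u (g^[i] u) := by
        intro i hi
        have hmem : ∀ i ≤ k, g^[i] u ∉ S := fun i hi hiS => hcon _ hiS (k - i) (by
          rw [← Function.iterate_add_apply, Nat.sub_add_cancel hi])
        induction i with
        | zero => exact ConnIn.refl (A := {z | z ∉ S}) (hmem 0 hi)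
        | succ i ih =>
          refine (ih (by omega)).trans ?_
          have e1 := hmem i (by omega)
          have e2 := hmem (i + 1) hi
          rw [Function.iterate_succ_apply'] at e2 ⊢
          rcases hgadj (g^[i] u) with h | h
          · rw [h]; exact ConnIn.refl (A := {z | z ∉ S}) e1
          · exact ConnIn.of_adj h e1 e2
      exact hS u (hRy.trans (key k le_rfl).symm) (Or.inr hu)

/-- A sequence of successive extensions that starts with `∅`, `{r}` and exhausts the graph, such
that the rays finitely separated from all balls are finitely separated from all its members. -/
theorem exists_extension_sequence (hG : G.Connected) (r : V) :
    ∃ (W : ℕ → Set V) (a f : ℕ → V → V) (d : ℕ → V → ℕ), W 0 = ∅ ∧ W 1 = {r} ∧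
      (∀ n, G.IsExtension (W n) (W (n + 1)) (W (n + 2)) (a n) (f n) (d n)) ∧
      (∀ x, ∃ n, x ∈ W n) ∧
      ∀ R : Ray G, (∀ n, R.FinSep (G.ballAround r n)) → ∀ n, R.FinSep (W n) := by
  have : Nonempty V := ⟨r⟩
  have h0 : G.Meets ∅ {r} := by
    refine ⟨Set.empty_subset _, fun x _ => ⟨r, rfl, ?_⟩⟩
    obtain ⟨p⟩ := hG.preconnected x r
    exact ⟨p, by simp⟩
  let St := {s : Set V × Set V // G.Meets s.1 s.2}
  have step : ∀ (s : St) (U : Set V), ∃ (B' : Set V) (a f : V → V) (d : V → ℕ),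
      G.IsExtension s.1.1 s.1.2 B' a f d ∧ U ⊆ B' ∧
      ∀ R : Ray G, R.FinSep (s.1.2 ∪ U) → R.FinSep B' := fun s U => exists_isExtension s.2 U
  choose nxt a f d hext hU hsep using step
  let st : ℕ → St := fun n => Nat.rec ⟨(∅, {r}), h0⟩
    (fun n s => ⟨(s.1.2, nxt s (G.ballAround r n)), (hext s _).meets⟩) n
  have hst : ∀ n, st (n + 1) =
    ⟨((st n).1.2, nxt (st n) (G.ballAround r n)), (hext (st n) _).meets⟩ := fun n => rfl
  refine ⟨fun n => (st n).1.1, fun n => a (st n) (G.ballAround r n),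
    fun n => f (st n) (G.ballAround r n), fun n => d (st n) (G.ballAround r n), rfl, rfl,
    fun n => hext (st n) (G.ballAround r n), fun x => ?_, fun R hR n => ?_⟩
  · obtain ⟨n, hn⟩ := exists_mem_ballAround hG r x
    exact ⟨n + 2, hU (st n) _ hn⟩
  · suffices h : R.FinSep (st n).1.1 ∧ R.FinSep (st n).1.2 from h.1
    induction n with
    | zero => exact ⟨R.finSep_empty, R.finSep_singleton r⟩
    | succ n ih => exact ⟨ih.2, hsep (st n) _ R (ih.2.union (hR n))⟩

/-! ### Trees from parent functions -/

/-- `p` is the parent function of a spanning tree of `G` with root `r`. -/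
structure IsParent (G : SimpleGraph V) (r : V) (p : V → V) : Prop where
  root : p r = r
  adj : ∀ x ≠ r, G.Adj x (p x)
  reach : ∀ x, ∃ k, p^[k] x = r

namespace IsParent

variable {r : V} {p : V → V}

open Classical in
/-- The distance from the root. -/
noncomputable def depth (h : G.IsParent r p) (x : V) : ℕ := Nat.find (h.reach x)

theorem iterate_depth (h : G.IsParent r p) (x : V) : p^[h.depth x] x = r := by
  classical
  exact Nat.find_spec (h.reach x)

theorem depth_root (h : G.IsParent r p) : h.depth r = 0 := by
  classical
  exact (Nat.find_eq_zero (h.reach r)).2 rfl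

theorem eq_root_of_depth (h : G.IsParent r p) {x : V} (hx : h.depth x = 0) : x = r := by
  have := h.iterate_depth x
  rwa [hx] at this

theorem depth_parent (h : G.IsParent r p) (x : V) : h.depth (p x) = h.depth x - 1 := by
  classical
  by_cases hx : x = r
  · rw [hx, h.root, h.depth_root]
  have hpos : h.depth x ≠ 0 := fun h0 => hx (h.eq_root_of_depth h0)
  apply le_antisymm
  · refine Nat.find_min' _ ?_
    have := h.iterate_depth x
    rwa [← Nat.succ_pred_eq_of_ne_zero hpos, Function.iterate_succ_apply] at this
  · have : h.depth x ≤ h.depth (p x) + 1 :=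
      Nat.find_min' _ (by rw [Function.iterate_succ_apply]; exact h.iterate_depth (p x))
    omega

theorem depth_iterate (h : G.IsParent r p) (x : V) (k : ℕ) :
    h.depth (p^[k] x) = h.depth x - k := by
  induction k with
  | zero => rfl
  | succ k ih => rw [Function.iterate_succ_apply', h.depth_parent, ih]; omega

/-- The tree given by a parent function. -/
def tree (_ : G.IsParent r p) : SimpleGraph V := SimpleGraph.fromRel fun x y => p x = y

theorem tree_adj (h : G.IsParent r p) {x y : V} :
    h.tree.Adj x y ↔ x ≠ y ∧ (p x = y ∨ p y = x) := SimpleGraph.fromRel_adj _ _ _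

theorem tree_adj_parent (h : G.IsParent r p) {x : V} (hx : x ≠ r) : h.tree.Adj x (p x) :=
  h.tree_adj.2 ⟨(h.adj x hx).ne, Or.inl rfl⟩

theorem tree_le (h : G.IsParent r p) : h.tree ≤ G := by
  have key : ∀ x y, x ≠ y → p x = y → G.Adj x y := by
    rintro x _ hxy rfl
    exact h.adj x fun hx => hxy (by rw [hx, h.root])
  intro x y hxy
  obtain ⟨hne, h' | h'⟩ := h.tree_adj.1 hxy
  · exact key x y hne h'
  · exact (key y x hne.symm h').symm

theorem tree_reachable_iterate (h : G.IsParent r p) (x : V) (k : ℕ) :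
    h.tree.Reachable x (p^[k] x) := by
  induction k with
  | zero => exact Reachable.refl _
  | succ k ih =>
    rw [Function.iterate_succ_apply']
    by_cases hx : p^[k] x = r
    · rw [hx, h.root]; rwa [hx] at ih
    · exact ih.trans (h.tree_adj_parent hx).reachable

theorem tree_isTree (h : G.IsParent r p) : h.tree.IsTree := by
  have hr : ∀ x, h.tree.Reachable x r := fun x => by
    have := h.tree_reachable_iterate x (h.depth x)
    rwa [h.iterate_depth] at this
  have : Nonempty V := ⟨r⟩
  refine ⟨⟨fun x y => (hr x).trans (hr y).symm⟩, ?_⟩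
  have key : ∀ x, x ≠ p x → h.tree.IsBridge s(x, p x) := by
    intro x hx
    have hxr : x ≠ r := fun h' => hx (by rw [h', h.root])
    rw [isBridge_iff]
    rintro ⟨w⟩
    -- Without the edge from `x` to its parent, no walk leaves the set of descendants of `x`; by
    -- depth, `p x` is not among them.
    have hD : ∀ {y z : V}, (h.tree \ fromEdgeSet {s(x, p x)}).Walk y z →
        (∃ k, p^[k] y = x) → ∃ k, p^[k] z = x := by
      intro y z w
      induction w with
      | nil => exact id
      | @cons a b c hab w ih =>
        rintro ⟨k, hk⟩
        apply ih
        rw [sdiff_adj, fromEdgeSet_adj, h.tree_adj] at hab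
        obtain ⟨⟨hne, hpab | hpab⟩, hnot⟩ := hab
        · cases k with
          | zero =>
            refine absurd ⟨?_, hne⟩ hnot
            have hax : a = x := hk
            rw [← hpab, hax]; rfl
          | succ k => exact ⟨k, by rw [← hpab]; exact hk⟩
        · exact ⟨k + 1, by rw [Function.iterate_succ_apply, hpab, hk]⟩
    obtain ⟨k, hk⟩ := hD w ⟨0, rfl⟩
    have h1 := h.depth_iterate (p x) k
    rw [hk, h.depth_parent] at h1
    exact hxr (h.eq_root_of_depth (by omega))
  rw [isAcyclic_iff_forall_adj_isBridge]
  intro x y hxy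
  obtain ⟨hne, rfl | rfl⟩ := h.tree_adj.1 hxy
  · exact key x hne
  · rw [Sym2.eq_swap]; exact key y hne.symm

/-- Once a ray has moved away from the root, turning back towards it would repeat a vertex. -/
theorem ray_parent (h : G.IsParent r p) (R : Ray h.tree) (hR : R 0 = r) (k : ℕ) :
    p (R (k + 1)) = R k := by
  induction k with
  | zero =>
    obtain ⟨hne, h' | h'⟩ := h.tree_adj.1 (R.adj 0)
    · rw [hR, h.root] at h'
      exact absurd (hR.trans h') hne
    · exact h'
  | succ k ih =>
    obtain ⟨hne, h' | h'⟩ := h.tree_adj.1 (R.adj (k + 1))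
    · have := R.injective (ih.symm.trans h')
      omega
    · exact h'

theorem ray_iterate (h : G.IsParent r p) (R : Ray h.tree) (hR : R 0 = r) (k j : ℕ) :
    p^[j] (R (k + j)) = R k := by
  induction j with
  | zero => rfl
  | succ j ih => rw [Function.iterate_succ_apply, ← add_assoc, h.ray_parent R hR, ih]

theorem depth_ray (h : G.IsParent r p) (R : Ray h.tree) (hR : R 0 = r) (k : ℕ) :
    h.depth (R k) = k := by
  induction k with
  | zero => rw [hR, h.depth_root]
  | succ k ih =>
    have h1 := h.depth_parent (R (k + 1))
    rw [h.ray_parent R hR, ih] at h1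
    by_contra hne
    have h0 : k = 0 ∧ h.depth (R (k + 1)) = 0 := by omega
    have := R.injective ((h.eq_root_of_depth h0.2).trans hR.symm)
    omega

/-- A sequence of vertices, each an ancestor of the next, whose depths are unbounded, lies on a ray
from the root. -/
theorem exists_ray (h : G.IsParent r p) (c : ℕ → V) (hc : ∀ n, ∃ k, p^[k] (c (n + 1)) = c n)
    (hd : ∀ n, n ≤ h.depth (c n)) :
    ∃ R : Ray h.tree, R 0 = r ∧ ∀ n, R (h.depth (c n)) = c n := by
  have hc1 : ∀ n, p^[h.depth (c (n + 1)) - h.depth (c n)] (c (n + 1)) = c n ∧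
      h.depth (c n) ≤ h.depth (c (n + 1)) := by
    intro n
    obtain ⟨k, hk⟩ := hc n
    have h1 := h.depth_iterate (c (n + 1)) k
    rw [hk] at h1
    refine ⟨?_, by omega⟩
    -- `k` may exceed the depth, as iteration stays at `r`; then `c n` is `r`.
    by_cases hk' : k ≤ h.depth (c (n + 1))
    · rw [show h.depth (c (n + 1)) - h.depth (c n) = k by omega, hk]
    · have h0 : h.depth (c n) = 0 := by omega
      rw [h0, Nat.sub_zero, h.iterate_depth, h.eq_root_of_depth h0]
  have hc2 : ∀ n m, n ≤ m → ∀ k ≤ h.depth (c n),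
      p^[h.depth (c m) - k] (c m) = p^[h.depth (c n) - k] (c n) ∧
        h.depth (c n) ≤ h.depth (c m) := by
    intro n m hnm k hk
    induction m, hnm using Nat.le_induction with
    | base => exact ⟨rfl, le_rfl⟩
    | succ m hm ih =>
      obtain ⟨h1, h2⟩ := hc1 m
      refine ⟨?_, ih.2.trans h2⟩
      rw [← ih.1]
      calc p^[h.depth (c (m + 1)) - k] (c (m + 1))
          = p^[h.depth (c m) - k] (p^[h.depth (c (m + 1)) - h.depth (c m)] (c (m + 1))) := by
            rw [← Function.iterate_add_apply]
            congr 2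
            omega
        _ = p^[h.depth (c m) - k] (c m) := by rw [h1]
  let R : ℕ → V := fun k => p^[h.depth (c k) - k] (c k)
  have hdR : ∀ k, h.depth (R k) = k := fun k => by
    have := hd k
    rw [h.depth_iterate]; omega
  have hpR : ∀ k, p (R (k + 1)) = R k := by
    intro k
    have := hd (k + 1)
    rw [← Function.iterate_succ_apply' p, Nat.succ_eq_add_one,
      show h.depth (c (k + 1)) - (k + 1) + 1 = h.depth (c (k + 1)) - k by omega]
    exact (hc2 k (k + 1) (by omega) k (hd k)).1
  have hinj : Function.Injective R := fun i j hij => by rw [← hdR i, hij, hdR]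
  refine ⟨⟨R, hinj, fun k => h.tree_adj.2 ⟨fun hk => ?_, Or.inr (hpR k)⟩⟩, ?_, fun n => ?_⟩
  · have := hinj hk
    omega
  · exact h.eq_root_of_depth (hdR 0)
  · change p^[h.depth (c (h.depth (c n))) - h.depth (c n)] (c (h.depth (c n))) = c n
    rw [(hc2 n _ (hd n) _ le_rfl).1, Nat.sub_self]
    rfl

end IsParent

/-! ### Combining the levels into one tree -/

/-- A sequence of successive extensions starting with `∅` and `{r}` and exhausting the vertex set
yields a tree in which every component outside a member is entered through its root. -/
theorem exists_isParent {r : V} {W : ℕ → Set V} {a f : ℕ → V → V} {d : ℕ → V → ℕ}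
    (h0 : W 0 = ∅) (h1 : W 1 = {r})
    (hW : ∀ n, G.IsExtension (W n) (W (n + 1)) (W (n + 2)) (a n) (f n) (d n))
    (hcov : ∀ x, ∃ n, x ∈ W n) :
    ∃ p, G.IsParent r p ∧ (∀ n, ∀ x ∈ W n, p x ∈ W n) ∧
      ∀ n, ∀ x ∉ W (n + 1), ∃ k, p^[k] x = a n x := by
  classical
  have hmono : Monotone W := monotone_nat_of_le_succ fun n => by
    cases n with
    | zero => simp [h0]
    | succ n => exact (hW n).subset
  have hlev : ∀ x, x ≠ r → ∃ n, x ∈ W (n + 2) ∧ x ∉ W (n + 1) := by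
    intro x hx
    obtain ⟨m, hm⟩ : ∃ m, Nat.find (hcov x) = m + 2 := by
      refine ⟨Nat.find (hcov x) - 2, ?_⟩
      have hne : ¬ Nat.find (hcov x) ≤ 1 := fun hle => hx (by
        simpa [h1] using hmono hle (Nat.find_spec (hcov x)))
      omega
    exact ⟨m, hm ▸ Nat.find_spec (hcov x), Nat.find_min (hcov x) (by omega)⟩
  choose! l hl hl' using hlev
  have hr : ∀ n, r ∈ W (n + 1) := fun n => hmono (show 1 ≤ n + 1 by omega) (by simp [h1])
  have hne : ∀ {n x}, x ∉ W (n + 1) → x ≠ r := fun hx h => hx (h ▸ hr _)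
  have hluniq : ∀ {n x}, x ∈ W (n + 2) → x ∉ W (n + 1) → l x = n := by
    intro n x hx hx'
    have hxr := hne hx'
    have e1 : ¬ n + 2 ≤ l x + 1 := fun h => hl' x hxr (hmono h hx)
    have e2 : ¬ l x + 2 ≤ n + 1 := fun h => hx' (hmono h (hl x hxr))
    omega
  let p : V → V := fun x => if x = r then r else f (l x) x
  have hp : ∀ x, x ≠ r → p x = f (l x) x := fun x hx => if_neg hx
  have hpr : p r = r := if_pos rfl
  have hpadj : ∀ x ≠ r, G.Adj x (p x) := fun x hx => by
    rw [hp x hx]; exact (hW (l x)).adj x (hl x hx) (hl' x hx)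
  have hpW : ∀ x ≠ r, p x ∈ W (l x + 2) := by
    intro x hx
    rw [hp x hx]
    by_cases hxa : x = a (l x) x
    · exact (hW _).subset ((hW (l x)).parent_root_mem x (hl x hx) (hl' x hx) hxa).1
    · exact ((hW (l x)).parent_mem x (hl x hx) (hl' x hx) hxa).1
  -- Induction along parents, on the level and then on `d n`: a parent lies in an earlier level or
  -- has smaller `d n`.
  have hind : ∀ (P : V → Prop), P r →
      (∀ x, x ≠ r → P (p x) → P x) → ∀ x, P x := by
    intro P hPr hP
    have key : ∀ n x, x ∈ W (n + 1) → P x := by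
      intro n
      induction n with
      | zero =>
        intro x hx
        have : x = r := by simpa [h1] using hx
        rwa [this]
      | succ n ih =>
        intro x hx
        induction hm : d n x using Nat.strong_induction_on generalizing x with
        | _ m ih' =>
          by_cases hx' : x ∈ W (n + 1)
          · exact ih x hx'
          have hxr := hne hx'
          have hln := hluniq hx hx'
          refine hP x hxr ?_
          rw [hp x hxr, hln]
          by_cases hxa : x = a n x
          · exact ih _ ((hW n).parent_root_mem x hx hx' hxa).1
          · obtain ⟨e1, -, e3⟩ := (hW n).parent_mem x hx hx' hxa
            exact ih' _ (hm ▸ e3) _ e1 rfl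
    intro x
    obtain ⟨n, hn⟩ := hcov x
    exact key n x (hmono (Nat.le_succ n) hn)
  refine ⟨p, ⟨hpr, hpadj, ?_⟩, ?_, ?_⟩
  · refine hind _ ⟨0, rfl⟩ fun x _ hx => ?_
    obtain ⟨k, hk⟩ := hx
    exact ⟨k + 1, hk⟩
  · intro n x hx
    by_cases hxr : x = r
    · rwa [hxr, hpr, ← hxr]
    · refine hmono ?_ (hpW x hxr)
      by_contra hlt
      exact hl' x hxr (hmono (by omega) hx)
  · intro n
    refine hind _ (fun h => absurd (hr n) h) fun x hxr ih hx => ?_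
    by_cases hxa : x = a n x
    · exact ⟨0, hxa⟩
    have hnl : n ≤ l x := by
      by_contra hlt
      exact hx (hmono (by omega) (hl x hxr))
    have hpx : p x ∉ W (n + 1) := by
      rw [hp x hxr]
      -- If `x` is a root of a later level, its parent avoids `W (l x)`, which contains `W (n + 1)`.
      -- This is why roots must attach outside `A`.
      by_cases hxl : x = a (l x) x
      · have e1 := ((hW (l x)).parent_root_mem x (hl x hxr) (hl' x hxr) hxl).2
        have e2 : n ≠ l x := fun e => hxa (by rw [e]; exact hxl)
        exact fun e => e1 (hmono (by omega) e)
      · have e1 := ((hW (l x)).parent_mem x (hl x hxr) (hl' x hxr) hxl).2.1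
        exact fun e => e1 (hmono (by omega) e)
    obtain ⟨k, hk⟩ := ih hpx
    refine ⟨k + 1, ?_⟩
    rw [Function.iterate_succ_apply, hk]
    exact ((hW n).root_eq _ _ (ConnIn.of_adj (hpadj x hxr) hx hpx)).symm

end SimpleGraph

/-! ### End-faithfulness of the tree -/

open SimpleGraph in
theorem corollary2 {V : Type*} (G : SimpleGraph V) (hG : G.Connected) :
    ∃ (T : SimpleGraph V) (r : V), G.IsEndFaithfulSpanningTree T r G.topologicalEnds := by
  classical
  obtain ⟨r⟩ := hG.nonempty
  obtain ⟨W, a, f, d, h0, h1, hW, hcov, hsep⟩ := exists_extension_sequence hG r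
  obtain ⟨p, hp, hpW, hpa⟩ := exists_isParent h0 h1 hW hcov
  have hmono : Monotone W := monotone_nat_of_le_succ fun n => by
    cases n with
    | zero => simp [h0]
    | succ n => exact (hW n).subset
  have hit : ∀ n k, ∀ x ∈ W n, p^[k] x ∈ W n := by
    intro n k x hx
    induction k with
    | zero => exact hx
    | succ k ih => rw [Function.iterate_succ_apply']; exact hpW n _ ih
  refine ⟨hp.tree, r, hp.tree_le, hp.tree_isTree, fun ω hω => ?_⟩
  have hfs : ∀ R : Ray G, R.vertexEnd = ω → ∀ n, R.FinSep (W n) := fun R hR =>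
    hsep R fun n => R.finSep_ballAround (fun v hv => hω v ⟨R, hR, hv⟩) r n
  obtain ⟨R₀, hR₀⟩ : ∃ R : Ray G, R.vertexEnd = ω := Quotient.exists_rep ω
  choose N hN using fun n => (hfs R₀ hR₀ n).exists_tail
  -- the roots of the components containing tails of `R₀`
  let c : ℕ → V := fun n => a n (R₀ (N (n + 1)))
  have hcR : ∀ n, G.ConnIn (W (n + 1))ᶜ (R₀ (N (n + 1))) (c n) := fun n =>
    (hW n).conn_root _ (hN (n + 1) _ le_rfl)
  have hcW : ∀ n, c n ∈ W (n + 2) := fun n => (hW n).root_mem _ (hN (n + 1) _ le_rfl)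
  have hcW' : ∀ n, c n ∉ W (n + 1) := fun n => (hcR n).right_mem
  have hcc : ∀ n, ∃ k, p^[k] (c (n + 1)) = c n := by
    intro n
    have hsub : (W (n + 2))ᶜ ⊆ (W (n + 1))ᶜ := Set.compl_subset_compl.2 (hmono (by omega))
    obtain ⟨k, hk⟩ := hpa n (c (n + 1)) (hsub (hcW' (n + 1)))
    refine ⟨k, hk.trans ?_⟩
    refine ((hW n).root_eq _ _ ((R₀.connIn_tail (A := (W (n + 1))ᶜ)
      (N := min (N (n + 1)) (N (n + 2))) ?_ (min_le_left _ _) (min_le_right _ _)).trans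
        ((hcR (n + 1)).mono hsub))).symm
    intro m hm
    -- `N (n + 1)` and `N (n + 2)` need not be ordered; a tail from either index avoids `W (n + 1)`.
    rcases min_le_iff.1 hm with h | h
    · exact hN (n + 1) m h
    · exact hsub (hN (n + 2) m h)
  have hcd : ∀ n, n ≤ hp.depth (c n) := by
    intro n
    induction n with
    | zero => exact Nat.zero_le _
    | succ n ih =>
      obtain ⟨k, hk⟩ := hcc n
      have hk0 : k ≠ 0 := by
        rintro rfl
        exact hcW' (n + 1) (by rw [show c (n + 1) = c n from hk]; exact hcW n)
      have e1 := hp.depth_iterate (c (n + 1)) k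
      rw [hk] at e1
      by_contra hlt
      refine hcW' (n + 1) ?_
      rw [hp.eq_root_of_depth (x := c (n + 1)) (by omega)]
      exact hmono (show 1 ≤ n + 2 by omega) (by simp [h1])
  obtain ⟨R, hR0, hRc⟩ := hp.exists_ray c hcc hcd
  have hRω : (R.mapLe hp.tree_le).vertexEnd = ω := by
    rw [← hR₀]
    refine Quotient.sound (s := Ray.setoid G) (Ray.Equivalent.symm fun S => ?_)
    obtain ⟨n, hn⟩ : ∃ n, ∀ x ∈ S, x ∈ W (n + 1) := by
      choose m hm using hcov
      exact ⟨S.sup m, fun x hx => hmono ((Finset.le_sup hx).trans (Nat.le_succ _)) (hm x)⟩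
    obtain ⟨q, hq⟩ : G.ConnIn (W (n + 1))ᶜ (R₀ (N (n + 1))) (R (hp.depth (c n))) := by
      rw [hRc]; exact hcR n
    exact ⟨N (n + 1), hp.depth (c n), q, fun x hx hxS => hq x hx (hn x hxS)⟩
  refine ⟨R, ⟨hR0, hRω⟩, ?_⟩
  rintro R' ⟨hR'0, hR'⟩
  ext k
  obtain ⟨n, hn, hn'⟩ : ∃ n, R k ∈ W (n + 1) ∧ R' k ∈ W (n + 1) := by
    obtain ⟨i, hi⟩ := hcov (R k)
    obtain ⟨j, hj⟩ := hcov (R' k)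
    exact ⟨max i j, hmono (by omega) hi, hmono (by omega) hj⟩
  -- The component's root lies on `Q`, not before `Q k` because `W (n + 1)` is closed under parents.
  -- Hence the root and `k` determine `Q k`.
  have hdet : ∀ (Q : Ray hp.tree) (i : ℕ), Q 0 = r → Q k ∈ W (n + 1) → Q i ∉ W (n + 1) →
      Q k = p^[hp.depth (a n (Q i)) - k] (a n (Q i)) := by
    intro Q i hQ hk hi
    obtain ⟨l, hl⟩ := hpa n (Q i) hi
    have hroot : a n (Q i) ∉ W (n + 1) := ((hW n).conn_root _ hi).right_mem
    have hdep : hp.depth (a n (Q i)) = i - l := by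
      rw [← hl, hp.depth_iterate, hp.depth_ray Q hQ]
    have hli : l ≤ i := by
      by_contra hlt
      refine hroot ?_
      rw [hp.eq_root_of_depth (x := a n (Q i)) (by omega)]
      exact hmono (show 1 ≤ n + 1 by omega) (by simp [h1])
    obtain ⟨m, rfl⟩ := Nat.exists_eq_add_of_le' hli
    rw [hp.ray_iterate Q hQ] at hl
    rw [hdep, ← hl, Nat.add_sub_cancel]
    rw [← hl] at hroot
    have hkm : k ≤ m := by
      by_contra hlt
      obtain ⟨j, rfl⟩ := Nat.exists_eq_add_of_le (not_le.1 hlt).le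
      exact hroot (hp.ray_iterate Q hQ m j ▸ hit (n + 1) j _ hk)
    obtain ⟨j, rfl⟩ := Nat.exists_eq_add_of_le hkm
    rw [Nat.add_sub_cancel_left, hp.ray_iterate Q hQ]
  obtain ⟨i, j, hij⟩ := (hfs _ hRω (n + 1)).connIn_of_equivalent
    (Quotient.exact (s := Ray.setoid G) (hRω.trans hR'.symm))
  have hEq : a n (R i) = a n (R' j) := (hW n).root_eq _ _ hij
  change R' k = R k
  rw [hdet R i hR0 hn hij.left_mem, hdet R' j hR'0 hn' hij.right_mem, hEq]
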